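/- Let $a$ and $b$ be relatively prime integers with $b\neq 0$, and define the first and second Lucas sequences by $U_0=0$, $U_1=1$, $U_{k+2}=aU_{k+1}+bU_k$ and $V_0=2$, $V_1=a$, $V_{k+2}=aV_{k+1}+bV_k$ for $k\ge 0$. For a positive integer $m$ relatively prime to $b$, let $\tau(m)=\min\{k\ge 1 : m\mid U_k\}$ be the order of appearance of $m$ in $(U_k)_{k\ge0}$. Suppose that $a>0$ and $\Delta=a^2+4b>0$. Then for every positive integer $n$ and every prime $p\ge 3$, the integer $U_nU_{n+p}U_{n+2p}$ is positive and relatively prime to $b$, its order of appearance exists, and \[ \tau(U_nU_{n+p}U_{n+2p})= \begin{cases} n(n+p)(n+2p), & \text{if } p\nmid n \text{ and } 2\nmid n,\\[4pt] \dfrac{n(n+p)(n+2p)}{2}\cdot\dfrac{a}{\gcd(a,\,n+p)}, & \text{if } p\nmid n \text{ and } 2\mid n,\\[8pt] \dfrac{n(n+p)(n+2p)}{p^2}\,U_p^2, & \text{if } p\mid n \text{ and } 2\nmid n,\\[8pt] \dfrac{n(n+p)(n+2p)}{2p^2}\cdot\dfrac{U_p^2V_p}{\gcd\left(V_p,\,(n+p)/p\right)},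 & \text{if } p\mid n \text{ and } 2\mid n. \end{cases} \] -/

import Mathlib

/-- The first Lucas sequence `U_n(a, b)`: `U_0 = 0`, `U_1 = 1`, `U_{n+2} = a U_{n+1} + b U_n`. -/
def lucasU (a b : ℤ) : ℕ → ℤ
  | 0 => 0
  | 1 => 1
  | n + 2 => a * lucasU a b (n + 1) + b * lucasU a b n

/-- The second Lucas sequence `V_n(a, b)`: `V_0 = 2`, `V_1 = a`, `V_{n+2} = a V_{n+1} + b V_n`. -/
def lucasV (a b : ℤ) : ℕ → ℤ
  | 0 => 2
  | 1 => a
  | n + 2 => a * lucasV a b (n + 1) + b * lucasV a b n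

/-- The positive integers `k` with `m ∣ U_k(a, b)`. -/
def appearanceSet (a b m : ℤ) : Set ℕ :=
  {k : ℕ | 1 ≤ k ∧ m ∣ lucasU a b k}

/-- The order of appearance `τ(m)` of `m` in the sequence `U_n(a, b)`: the smallest positive
integer `k` with `m ∣ U_k`. It is meant for a positive integer `m` relatively prime to `b`; where
no such `k` exists the value is `0`, so it is positive exactly where the minimum exists. -/
noncomputable def orderOfAppearance (a b m : ℤ) : ℕ :=
  sInf (appearanceSet a b m)

/-!
Put `d = gcd (n, p)`. Then `U_{dk} = U_d U'_k`, where `U'` is the Lucas sequence with parameters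
`(V_d, -(-b)^d)`, whose discriminant is `(a² + 4b) U_d²`. Since `a` and `a² + 4b` are positive,
`U_i ∣ U_k` forces `i ∣ k` for `i ≠ 2`, so `k` is a multiple of the least common multiple of the
three indices. The remaining factor of `k` is found one prime `q` at a time by lifting the exponent:
`v_q (U_{rk}) = v_q (U_r) + v_q (k)` whenever `q² ∣ (a² + 4b) U_r²`, with an extra condition at
`q = 2`. The primes dividing `U_d` account for `U_d²`. The only common prime divisors of the three
terms of `U'` are those dividing `U'_2 = V_d` when `n` is even, and they account for the factor
`V_d / gcd (V_d, (n + p) / d)`.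
-/

section Identities

variable (a b : ℤ)

@[simp] theorem lucasU_zero : lucasU a b 0 = 0 := rfl

@[simp] theorem lucasU_one : lucasU a b 1 = 1 := rfl

theorem lucasU_add_two (k : ℕ) :
    lucasU a b (k + 2) = a * lucasU a b (k + 1) + b * lucasU a b k := rfl

@[simp] theorem lucasU_two : lucasU a b 2 = a := by simp [lucasU_add_two]

@[simp] theorem lucasV_zero : lucasV a b 0 = 2 := rfl

@[simp] theorem lucasV_one : lucasV a b 1 = a := rfl

theorem lucasV_add_two (k : ℕ) :
    lucasV a b (k + 2) = a * lucasV a b (k + 1) + b * lucasV a b k := rfl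

theorem lucasV_eq (k : ℕ) : lucasV a b k = 2 * lucasU a b (k + 1) - a * lucasU a b k := by
  induction k using Nat.twoStepInduction with
  | zero => simp
  | one => simp; ring
  | more k h₁ h₂ =>
    rw [lucasV_add_two, h₁, h₂, lucasU_add_two _ _ (k + 1), lucasU_add_two]
    ring

theorem two_mul_lucasU_succ (k : ℕ) :
    2 * lucasU a b (k + 1) = a * lucasU a b k + lucasV a b k := by
  rw [lucasV_eq]; ring

theorem two_mul_lucasV_succ (k : ℕ) :
    2 * lucasV a b (k + 1) = a * lucasV a b k + (a ^ 2 + 4 * b) * lucasU a b k := by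
  rw [lucasV_eq, lucasV_eq, lucasU_add_two]; ring

theorem lucasU_cassini (k : ℕ) :
    lucasU a b (k + 1) ^ 2 - a * lucasU a b (k + 1) * lucasU a b k - b * lucasU a b k ^ 2 =
      (-b) ^ k := by
  induction k with
  | zero => simp
  | succ k ih => rw [lucasU_add_two, pow_succ (-b), ← ih]; ring

theorem lucasU_add (m k : ℕ) :
    lucasU a b (m + k) = lucasU a b m * (lucasU a b (k + 1) - a * lucasU a b k) +
      lucasU a b (m + 1) * lucasU a b k := by
  induction k using Nat.twoStepInduction with
  | zero => simp
  | one => simp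
  | more k h₁ h₂ =>
    rw [← add_assoc, lucasU_add_two, add_assoc m, h₁, h₂, lucasU_add_two _ _ (k + 1),
      lucasU_add_two]
    ring

theorem lucasU_two_mul (k : ℕ) : lucasU a b (2 * k) = lucasU a b k * lucasV a b k := by
  rw [two_mul, lucasU_add, lucasV_eq]; ring

theorem lucasV_sq_sub (k : ℕ) :
    lucasV a b k ^ 2 - (a ^ 2 + 4 * b) * lucasU a b k ^ 2 = 4 * (-b) ^ k := by
  rw [lucasV_eq, ← lucasU_cassini]; ring

theorem lucasU_add_add (s r : ℕ) :
    lucasU a b (s + r + r) =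
      lucasV a b r * lucasU a b (s + r) + -(-b) ^ r * lucasU a b s := by
  have hsucc : lucasU a b (s + r + 1) =
      lucasU a b (s + 1) * lucasU a b (r + 1) + b * lucasU a b s * lucasU a b r := by
    rw [add_assoc, lucasU_add, lucasU_add_two]; ring
  rw [lucasU_add _ _ (s + r), hsucc, lucasU_add, lucasV_eq, ← lucasU_cassini]
  ring

theorem lucasU_mul (r k : ℕ) :
    lucasU a b (r * k) = lucasU a b r * lucasU (lucasV a b r) (-(-b) ^ r) k := by
  induction k using Nat.twoStepInduction with
  | zero => simp
  | one => simp
  | more k h₁ h₂ =>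
    rw [lucasU_add_two, show r * (k + 2) = r * k + r + r by ring, lucasU_add_add,
      ← mul_add_one, h₁, h₂]
    ring

theorem discrim_lucasV (r : ℕ) :
    lucasV a b r ^ 2 + 4 * -(-b) ^ r = (a ^ 2 + 4 * b) * lucasU a b r ^ 2 := by
  rw [mul_neg, ← lucasV_sq_sub]; ring

theorem lucasU_dvd_lucasU {m n : ℕ} (h : m ∣ n) : lucasU a b m ∣ lucasU a b n := by
  obtain ⟨k, rfl⟩ := h
  exact ⟨_, lucasU_mul a b m k⟩

end Identities

section Coprimality

variable {a b : ℤ}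

theorem isCoprime_lucasU (hab : IsCoprime a b) {k : ℕ} (hk : 0 < k) :
    IsCoprime (lucasU a b k) b := by
  induction k, hk using Nat.le_induction with
  | base => simpa using isCoprime_one_left
  | succ k hk ih =>
    obtain ⟨k, rfl⟩ := Nat.exists_eq_add_of_le' hk
    rw [lucasU_add_two]
    exact (hab.mul_left ih).add_mul_left_left _

theorem isCoprime_lucasU_succ (hab : IsCoprime a b) (k : ℕ) :
    IsCoprime (lucasU a b k) (lucasU a b (k + 1)) := by
  induction k with
  | zero => simpa using isCoprime_one_right
  | succ k ih =>
    rw [lucasU_add_two, add_comm (a * _)]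
    exact ((isCoprime_lucasU hab k.succ_pos).mul_right ih.symm).add_mul_right_right _

theorem isCoprime_lucasV (hab : IsCoprime a b) (k : ℕ) :
    IsCoprime (lucasV a b k) (-(-b) ^ k) := by
  rcases k with _ | k
  · simp
  suffices IsCoprime (lucasV a b (k + 1)) b from this.neg_right.pow_right.neg_right
  induction k with
  | zero => simpa using hab
  | succ k ih =>
    rw [lucasV_add_two]
    exact (hab.mul_left ih).add_mul_left_left _

theorem dvd_lucasU_gcd (hab : IsCoprime a b) {d : ℤ} {m n : ℕ}
    (hm : d ∣ lucasU a b m) (hn : d ∣ lucasU a b n) : d ∣ lucasU a b (m.gcd n) := by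
  have cancel {m k : ℕ} (hm : d ∣ lucasU a b m) (hmk : d ∣ lucasU a b (m + k)) :
      d ∣ lucasU a b k := by
    rw [lucasU_add] at hmk
    exact ((isCoprime_lucasU_succ hab m).of_isCoprime_of_dvd_left hm).dvd_of_dvd_mul_left
      ((dvd_add_right (hm.mul_right _)).1 hmk)
  induction m, n using Nat.gcd.induction with
  | H0 n => simpa using hn
  | H1 m n _ ih =>
    rw [Nat.gcd_rec]
    refine ih (cancel (hm.trans (lucasU_dvd_lucasU a b (dvd_mul_right m (n / m)))) ?_) hm
    rwa [Nat.div_add_mod]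

theorem isCoprime_lucasU_lucasU (hab : IsCoprime a b) {m n : ℕ} (h : m.Coprime n) :
    IsCoprime (lucasU a b m) (lucasU a b n) := by
  rw [Int.isCoprime_iff_gcd_eq_one]
  have hdvd := dvd_lucasU_gcd hab (Int.gcd_dvd_left (lucasU a b m) (lucasU a b n))
    (Int.gcd_dvd_right _ _)
  rw [h, lucasU_one] at hdvd
  exact_mod_cast Int.eq_one_of_dvd_one (by positivity) hdvd

end Coprimality

section Growth

variable {a b : ℤ}

theorem lucasU_pos_and_lucasV_pos (ha : 0 < a) (hΔ : 0 < a ^ 2 + 4 * b) {k : ℕ} (hk : 0 < k) :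
    0 < lucasU a b k ∧ 0 < lucasV a b k := by
  induction k, hk using Nat.le_induction with
  | base => simp [ha]
  | succ k _ ih =>
    obtain ⟨hU, hV⟩ := ih
    have hU' : 0 < 2 * lucasU a b (k + 1) := by rw [two_mul_lucasU_succ]; positivity
    have hV' : 0 < 2 * lucasV a b (k + 1) := by rw [two_mul_lucasV_succ]; positivity
    constructor <;> linarith

theorem lucasU_pos (ha : 0 < a) (hΔ : 0 < a ^ 2 + 4 * b) {k : ℕ} (hk : 0 < k) :
    0 < lucasU a b k :=
  (lucasU_pos_and_lucasV_pos ha hΔ hk).1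

theorem lucasV_pos (ha : 0 < a) (hΔ : 0 < a ^ 2 + 4 * b) {k : ℕ} (hk : 0 < k) :
    0 < lucasV a b k :=
  (lucasU_pos_and_lucasV_pos ha hΔ hk).2

theorem lucasU_lt_succ (hb : b ≠ 0) (ha : 0 < a) (hΔ : 0 < a ^ 2 + 4 * b) {k : ℕ}
    (hk : 2 ≤ k) : lucasU a b k < lucasU a b (k + 1) := by
  obtain ⟨k, rfl⟩ := Nat.exists_eq_add_of_le' hk
  rcases eq_or_lt_of_le (show 1 ≤ a from ha) with rfl | ha1
  · have hb_pos : 0 < b := by omega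
    have hU := mul_pos hb_pos (lucasU_pos ha hΔ k.succ_pos)
    rw [lucasU_add_two _ _ (k + 1)]
    linarith
  · have hU := lucasU_pos ha hΔ (show 0 < k + 2 by omega)
    have hV := lucasV_pos ha hΔ (show 0 < k + 2 by omega)
    nlinarith [two_mul_lucasU_succ a b (k + 2)]

theorem lucasU_lt_lucasU (hb : b ≠ 0) (ha : 0 < a) (hΔ : 0 < a ^ 2 + 4 * b) {k n : ℕ}
    (hkn : k < n) (hn : n ≠ 2) : lucasU a b k < lucasU a b n := by
  have hmono : Monotone (lucasU a b) := monotone_nat_of_le_succ fun k => by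
    match k with
    | 0 => simp
    | 1 => simpa using Int.add_one_le_of_lt ha
    | k + 2 => exact (lucasU_lt_succ hb ha hΔ (by omega)).le
  obtain ⟨n, rfl⟩ := Nat.exists_eq_add_of_le' (show 1 ≤ n by omega)
  rcases Nat.eq_zero_or_pos n with rfl | hn0
  · simp [show k = 0 by omega]
  · exact (hmono (show k ≤ n by omega)).trans_lt (lucasU_lt_succ hb ha hΔ (by omega))

theorem dvd_of_lucasU_dvd_lucasU (hab : IsCoprime a b) (hb : b ≠ 0) (ha : 0 < a)
    (hΔ : 0 < a ^ 2 + 4 * b) {n k : ℕ} (hn : n ≠ 2) (h : lucasU a b n ∣ lucasU a b k) :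
    n ∣ k := by
  rcases Nat.eq_zero_or_pos n with rfl | hn0
  · rcases Nat.eq_zero_or_pos k with rfl | hk
    · exact dvd_rfl
    · exact absurd (zero_dvd_iff.1 h) (lucasU_pos ha hΔ hk).ne'
  have hg : 0 < n.gcd k := Nat.gcd_pos_of_pos_left _ hn0
  have hle : lucasU a b n ≤ lucasU a b (n.gcd k) :=
    Int.le_of_dvd (lucasU_pos ha hΔ hg) (dvd_lucasU_gcd hab dvd_rfl h)
  have hnlt : ¬ n.gcd k < n := fun hlt => (lucasU_lt_lucasU hb ha hΔ hlt hn).not_ge hle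
  exact Nat.gcd_eq_left_iff_dvd.1 ((Nat.gcd_le_left k hn0).antisymm (not_lt.1 hnlt))

end Growth

section Valuation

-- Modulo the discriminant both roots of `X ^ 2 - a X - b` are `a / 2`; the powers of `2` and the
-- factor `a` below clear the denominators of `V_k = 2 (a / 2) ^ k` and `U_k = k (a / 2) ^ (k - 1)`.
theorem two_pow_mul_lucasV_modEq (a b : ℤ) (k : ℕ) :
    2 ^ k * lucasV a b k ≡ 2 * a ^ k [ZMOD a ^ 2 + 4 * b] := by
  induction k with
  | zero => simp
  | succ k ih =>
    have hΔ : (a ^ 2 + 4 * b) * (2 ^ k * lucasU a b k) ≡ 0 [ZMOD a ^ 2 + 4 * b] :=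
      Int.modEq_zero_iff_dvd.2 (dvd_mul_right _ _)
    calc 2 ^ (k + 1) * lucasV a b (k + 1)
        = a * (2 ^ k * lucasV a b k) + (a ^ 2 + 4 * b) * (2 ^ k * lucasU a b k) := by
          rw [pow_succ, mul_assoc, two_mul_lucasV_succ]; ring
      _ ≡ a * (2 * a ^ k) + 0 [ZMOD a ^ 2 + 4 * b] := (ih.mul_left a).add hΔ
      _ = 2 * a ^ (k + 1) := by ring

theorem two_pow_mul_lucasU_modEq (a b : ℤ) (k : ℕ) :
    2 ^ k * a * lucasU a b k ≡ k * (2 * a ^ k) [ZMOD a ^ 2 + 4 * b] := by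
  induction k with
  | zero => simp
  | succ k ih =>
    calc 2 ^ (k + 1) * a * lucasU a b (k + 1)
        = a * (2 ^ k * a * lucasU a b k) + a * (2 ^ k * lucasV a b k) := by
          rw [pow_succ, mul_assoc, mul_assoc, mul_left_comm 2, two_mul_lucasU_succ]; ring
      _ ≡ a * (k * (2 * a ^ k)) + a * (2 * a ^ k) [ZMOD a ^ 2 + 4 * b] :=
          (ih.mul_left a).add ((two_pow_mul_lucasV_modEq a b k).mul_left a)
      _ = (k + 1 : ℕ) * (2 * a ^ (k + 1)) := by push_cast; ring

variable {a b : ℤ} {q : ℕ} [Fact q.Prime]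

theorem not_dvd_of_dvd_discrim (hab : IsCoprime a b) (hq2 : q ≠ 2)
    (hq : (q : ℤ) ∣ a ^ 2 + 4 * b) : ¬ (q : ℤ) ∣ a := by
  intro hqa
  have hq4 : (q : ℤ) ∣ 2 ^ 2 :=
    (hab.of_isCoprime_of_dvd_left hqa).dvd_of_dvd_mul_right
      ((dvd_add_right (dvd_pow hqa two_ne_zero)).1 hq)
  have hq2' : q ∣ 2 := Nat.Prime.dvd_of_dvd_pow Fact.out (by exact_mod_cast hq4)
  exact hq2 ((Nat.prime_dvd_prime_iff_eq Fact.out Nat.prime_two).1 hq2')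

theorem two_dvd_of_two_dvd_discrim (h : 2 ∣ a ^ 2 + 4 * b) : 2 ∣ a :=
  Int.prime_two.dvd_of_dvd_pow (n := 2) (by omega)

theorem not_dvd_two_mul_pow (hab : IsCoprime a b) (hq2 : q ≠ 2)
    (hq : (q : ℤ) ∣ a ^ 2 + 4 * b) (k : ℕ) : ¬ (q : ℤ) ∣ 2 * a ^ k := by
  have hq' : Prime (q : ℤ) := Nat.prime_iff_prime_int.1 Fact.out
  have hq2' : ¬ (q : ℤ) ∣ 2 := fun h =>
    hq2 ((Nat.prime_dvd_prime_iff_eq Fact.out Nat.prime_two).1 (by exact_mod_cast h))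
  exact fun h => (hq'.dvd_or_dvd h).elim hq2' fun h =>
    not_dvd_of_dvd_discrim hab hq2 hq (hq'.dvd_of_dvd_pow h)

theorem prime_dvd_lucasU_self (hab : IsCoprime a b) (hq : (q : ℤ) ∣ a ^ 2 + 4 * b) :
    (q : ℤ) ∣ lucasU a b q := by
  rcases eq_or_ne q 2 with rfl | hq2
  · simpa using two_dvd_of_two_dvd_discrim hq
  have hq' : Prime (q : ℤ) := Nat.prime_iff_prime_int.1 Fact.out
  have hdvd : (q : ℤ) ∣ 2 ^ q * a * lucasU a b q :=
    (((two_pow_mul_lucasU_modEq a b q).of_dvd hq).dvd_iff).2 (dvd_mul_right _ _)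
  refine (hq'.dvd_or_dvd hdvd).resolve_left fun h => ?_
  have : (q : ℤ) ∣ 2 := (hq'.dvd_or_dvd h).elim hq'.dvd_of_dvd_pow
    fun h => absurd h (not_dvd_of_dvd_discrim hab hq2 hq)
  exact not_dvd_two_mul_pow hab hq2 hq 0 (by simpa)

-- At `q = 2` it is not enough that `4` divides the discriminant: for `(a, b) = (4, 1)` it is `20`,
-- while `U_2 = 4`.
theorem prime_sq_not_dvd_lucasU_self (hab : IsCoprime a b) (hq : (q : ℤ) ^ 2 ∣ a ^ 2 + 4 * b)
    (h2 : q = 2 → 16 ∣ a ^ 2 + 4 * b) : ¬ (q : ℤ) ^ 2 ∣ lucasU a b q := by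
  intro hdvd
  rcases eq_or_ne q 2 with rfl | hq2
  · obtain ⟨c, rfl⟩ : 4 ∣ a := by simpa using hdvd
    have hb : 4 ∣ b := by
      obtain ⟨d, hd⟩ := h2 rfl
      exact ⟨d - c ^ 2, by linarith⟩
    have := Int.isUnit_iff.1 (hab.isUnit_of_dvd' (dvd_mul_right 4 c) hb)
    omega
  · have hq' : Prime (q : ℤ) := Nat.prime_iff_prime_int.1 Fact.out
    have h : (q : ℤ) ^ 2 ∣ q * (2 * a ^ q) :=
      (((two_pow_mul_lucasU_modEq a b q).of_dvd hq).dvd_iff).1 (hdvd.mul_left _)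
    rw [pow_two, mul_dvd_mul_iff_left hq'.ne_zero] at h
    exact not_dvd_two_mul_pow hab hq2 ((dvd_pow_self _ two_ne_zero).trans hq) q h

theorem padicValInt_lucasU_self (hab : IsCoprime a b) (hq : (q : ℤ) ^ 2 ∣ a ^ 2 + 4 * b)
    (h2 : q = 2 → 16 ∣ a ^ 2 + 4 * b) : padicValInt q (lucasU a b q) = 1 := by
  have hndvd := prime_sq_not_dvd_lucasU_self hab hq h2
  have hdvd : (q : ℤ) ^ 1 ∣ lucasU a b q := by
    simpa using prime_dvd_lucasU_self hab ((dvd_pow_self _ two_ne_zero).trans hq)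
  rw [padicValInt_dvd_iff, not_or, not_le] at hndvd
  rw [padicValInt_dvd_iff, or_iff_right hndvd.1] at hdvd
  omega

theorem prime_not_dvd_lucasU (hab : IsCoprime a b) (hq : (q : ℤ) ∣ a ^ 2 + 4 * b) {k : ℕ}
    (hk : ¬ q ∣ k) : ¬ (q : ℤ) ∣ lucasU a b k := by
  intro h
  have hone := dvd_lucasU_gcd hab (prime_dvd_lucasU_self hab hq) h
  rw [(Nat.Prime.coprime_iff_not_dvd Fact.out).2 hk, lucasU_one] at hone
  exact (Nat.prime_iff_prime_int.1 Fact.out).not_dvd_one hone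

theorem padicValInt_lucasU (hab : IsCoprime a b) (hq : (q : ℤ) ^ 2 ∣ a ^ 2 + 4 * b)
    (h2 : q = 2 → 16 ∣ a ^ 2 + 4 * b) {k : ℕ} (hk : lucasU a b k ≠ 0) :
    padicValInt q (lucasU a b k) = padicValNat q k := by
  have hq_prime : q.Prime := Fact.out
  induction k using Nat.strong_induction_on with
  | _ k ih =>
    by_cases hqk : q ∣ k
    · obtain ⟨j, rfl⟩ := hqk
      have hj0 : j ≠ 0 := by rintro rfl; simp at hk
      have hlt : j < q * j := by nlinarith [hq_prime.two_le, Nat.pos_of_ne_zero hj0]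
      rw [mul_comm, lucasU_mul] at hk ⊢
      obtain ⟨hj, hjq⟩ := mul_ne_zero_iff.1 hk
      rw [padicValInt.mul hj hjq, ih j hlt hj, padicValNat.mul hj0 hq_prime.ne_zero,
        padicValNat_self, padicValInt_lucasU_self (isCoprime_lucasV hab j)]
      · exact discrim_lucasV a b j ▸ hq.mul_right _
      · exact fun hq2 => discrim_lucasV a b j ▸ (h2 hq2).mul_right _
    · rw [padicValNat.eq_zero_of_not_dvd hqk, padicValInt.eq_zero_of_not_dvd]
      exact prime_not_dvd_lucasU hab ((dvd_pow_self _ two_ne_zero).trans hq) hqk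

theorem sixteen_dvd_discrim_mul_lucasU_sq {r : ℕ} (hr : 2 ∣ r)
    (h : 2 ∣ (a ^ 2 + 4 * b) * lucasU a b r) : 16 ∣ (a ^ 2 + 4 * b) * lucasU a b r ^ 2 := by
  by_cases hΔ : 2 ∣ a ^ 2 + 4 * b
  · obtain ⟨c, hc⟩ := two_dvd_of_two_dvd_discrim hΔ
    obtain ⟨d, hd⟩ : 2 ∣ lucasU a b r := by
      rw [← lucasU_two a b] at hc
      exact (Dvd.intro _ hc.symm).trans (lucasU_dvd_lucasU a b hr)
    exact ⟨(c ^ 2 + b) * d ^ 2, by rw [hd, hc]; ring⟩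
  · obtain ⟨s, rfl⟩ := hr
    have hUV : 2 ∣ lucasU a b s ↔ 2 ∣ lucasV a b s := by
      have hV := lucasV_sq_sub a b s
      rw [← Int.prime_two.dvd_pow_iff_dvd two_ne_zero,
        ← Int.prime_two.dvd_pow_iff_dvd (a := lucasV a b s) two_ne_zero,
        ← sub_add_cancel (lucasV a b s ^ 2) ((a ^ 2 + 4 * b) * lucasU a b s ^ 2), hV,
        dvd_add_right (by omega), Int.prime_two.dvd_mul, or_iff_right hΔ]
    have h4 : 2 * 2 ∣ lucasU a b (2 * s) := by
      have h' := (Int.prime_two.dvd_or_dvd h).resolve_left hΔ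
      rw [lucasU_two_mul, Int.prime_two.dvd_mul, ← hUV, or_self] at h'
      rw [lucasU_two_mul]
      exact mul_dvd_mul h' (hUV.1 h')
    exact (pow_dvd_pow_of_dvd h4 2).mul_left _

theorem padicValInt_lucasU_mul (hab : IsCoprime a b) {r k : ℕ}
    (hq : (q : ℤ) ^ 2 ∣ (a ^ 2 + 4 * b) * lucasU a b r ^ 2) (h2 : q = 2 → 2 ∣ r)
    (hrk : lucasU a b (r * k) ≠ 0) :
    padicValInt q (lucasU a b (r * k)) = padicValInt q (lucasU a b r) + padicValNat q k := by
  rw [lucasU_mul] at hrk ⊢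
  obtain ⟨hr, hk⟩ := mul_ne_zero_iff.1 hrk
  rw [padicValInt.mul hr hk, padicValInt_lucasU (isCoprime_lucasV hab r) _ _ hk]
  · rwa [discrim_lucasV]
  · rintro rfl
    rw [discrim_lucasV]
    refine sixteen_dvd_discrim_mul_lucasU_sq (h2 rfl) ?_
    have h : (2 : ℤ) ∣ (a ^ 2 + 4 * b) * lucasU a b r ^ 2 := (by decide : (2 : ℤ) ∣ 2 ^ 2).trans hq
    exact (Int.prime_two.dvd_or_dvd h).elim (·.mul_right _)
      fun h => (Int.prime_two.dvd_of_dvd_pow h).mul_left _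

end Valuation

section Triple

theorem int_dvd_iff_padicValInt_le {m n : ℤ} (hm : m ≠ 0) (hn : n ≠ 0) :
    m ∣ n ↔ ∀ (q : ℕ) [Fact q.Prime], padicValInt q m ≤ padicValInt q n := by
  rw [← Int.natAbs_dvd_natAbs, ← Nat.factorization_prime_le_iff_dvd (by simpa) (by simpa)]
  refine ⟨fun h q hq => ?_, fun h q hq => ?_⟩
  · simpa only [padicValInt, Nat.factorization_def _ hq.out] using h q hq.out
  · have : Fact q.Prime := ⟨hq⟩
    simpa only [padicValInt, Nat.factorization_def _ hq] using h q

theorem padicValInt_ediv_gcd {q : ℕ} [Fact q.Prime] {u : ℤ} {y : ℕ} (hu : u ≠ 0) (hy : y ≠ 0) :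
    padicValInt q (u / (Int.gcd u y : ℤ)) = padicValInt q u - padicValNat q y := by
  have hgcd : padicValNat q (u.natAbs.gcd y) = min (padicValNat q u.natAbs) (padicValNat q y) := by
    simp only [← Nat.factorization_def _ (Fact.out : q.Prime)]
    rw [Nat.factorization_gcd (by simpa) hy, Finsupp.inf_apply]
  have hdvd : (Int.gcd u y : ℤ) ∣ u := Int.gcd_dvd_left u y
  rw [padicValInt, Int.natAbs_ediv_of_dvd hdvd, Int.natAbs_natCast, Int.gcd, Int.natAbs_natCast,
    padicValNat.div_of_dvd (Nat.gcd_dvd_left _ _), hgcd, padicValInt]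
  omega

/-- The quotient `U_g / gcd (U_g, y)`, which for `g = 2` is the factor `a / gcd (a, y)` of the order
of appearance. It collects the prime powers of `U_g` that the index `y` does not supply. -/
def lucasCofactor (a b : ℤ) (g y : ℕ) : ℤ :=
  lucasU a b g / Int.gcd (lucasU a b g) y

variable {a b D : ℤ} {q g h h' y j : ℕ}

theorem lucasCofactor_mul_gcd (a b : ℤ) (g y : ℕ) :
    lucasCofactor a b g y * Int.gcd (lucasU a b g) y = lucasU a b g :=
  Int.ediv_mul_cancel (Int.gcd_dvd_left _ _)

theorem lucasCofactor_ne_zero (hg : lucasU a b g ≠ 0) : lucasCofactor a b g y ≠ 0 :=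
  left_ne_zero_of_mul (lucasCofactor_mul_gcd a b g y ▸ hg)

theorem lucasCofactor_pos (hg : 0 < lucasU a b g) : 0 < lucasCofactor a b g y :=
  pos_of_mul_pos_left (lucasCofactor_mul_gcd a b g y ▸ hg) (Int.natCast_nonneg _)

theorem cast_lucasCofactor (hg : lucasU a b g ≠ 0) :
    (lucasCofactor a b g y : ℚ) = lucasU a b g / Int.gcd (lucasU a b g) y := by
  have hgcd : (Int.gcd (lucasU a b g) y : ℚ) ≠ 0 := by
    exact_mod_cast right_ne_zero_of_mul (lucasCofactor_mul_gcd a b g y ▸ hg)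
  exact eq_div_of_mul_eq hgcd (by exact_mod_cast lucasCofactor_mul_gcd a b g y)

theorem lucasCofactor_one (a b : ℤ) (y : ℕ) : lucasCofactor a b 1 y = 1 := by
  simp [lucasCofactor]

-- `g h`, `y` and `g h'` stand for the three indices; their least common multiple is `g h h' y`.
theorem padicValInt_triple_le_iff_of_dvd_lucasU [Fact q.Prime] (hab : IsCoprime a b)
    (hD : D ^ 2 ∣ a ^ 2 + 4 * b) (hg : g ∣ 2) (hxy : (g * h).Coprime y)
    (hne : lucasU a b (g * h * h' * y * j) ≠ 0) (hq : (q : ℤ) ∣ lucasU a b g) :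
    2 * padicValInt q D + (padicValInt q (lucasU a b (g * h)) + padicValInt q (lucasU a b y) +
        padicValInt q (lucasU a b (g * h'))) ≤
      padicValInt q (lucasU a b (g * h * h' * y * j)) ↔
    2 * padicValInt q D + (padicValInt q (lucasU a b g) - padicValNat q y) ≤
      padicValNat q j := by
  have hq' : Prime (q : ℤ) := Nat.prime_iff_prime_int.1 Fact.out
  obtain rfl : g = 2 := ((Nat.dvd_prime Nat.prime_two).1 hg).resolve_left <| by
    rintro rfl
    exact hq'.not_dvd_one (by simpa using hq)
  have hmul {k : ℕ} (hk : lucasU a b (2 * k) ≠ 0) :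
      padicValInt q (lucasU a b (2 * k)) = padicValInt q (lucasU a b 2) + padicValNat q k :=
    padicValInt_lucasU_mul hab ((pow_dvd_pow_of_dvd hq 2).mul_left _) (fun _ => dvd_rfl) hk
  have hne_of_dvd {k : ℕ} (hk : k ∣ 2 * h * h' * y * j) : lucasU a b k ≠ 0 :=
    ne_zero_of_dvd_ne_zero hne (lucasU_dvd_lucasU a b hk)
  have hVy : padicValInt q (lucasU a b y) = 0 := padicValInt.eq_zero_of_not_dvd fun hqy =>
    hq'.not_isUnit ((isCoprime_lucasU_lucasU hab hxy.coprime_mul_right).isUnit_of_dvd' hq hqy)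
  have hDy : padicValInt q D = 0 ∨ padicValNat q y = 0 := by
    by_cases hqD : (q : ℤ) ∣ D
    · have hqΔ := (hqD.trans (dvd_pow_self D two_ne_zero)).trans hD
      have hq2 : q = 2 := by
        by_contra hq2
        exact not_dvd_of_dvd_discrim hab hq2 hqΔ (by simpa using hq)
      refine .inr (padicValNat.eq_zero_of_not_dvd ?_)
      rw [hq2, ← Nat.prime_two.coprime_iff_not_dvd]
      exact hxy.coprime_mul_right
    · exact .inl (padicValInt.eq_zero_of_not_dvd hqD)
  have hprod : h * h' * y * j ≠ 0 := by
    intro h0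
    rw [show 2 * h * h' * y * j = 2 * (h * h' * y * j) by ring, h0] at hne
    simp at hne
  simp only [mul_ne_zero_iff] at hprod
  rw [hVy, hmul (hne_of_dvd ⟨h' * y * j, by ring⟩), hmul (hne_of_dvd ⟨h * y * j, by ring⟩),
    show 2 * h * h' * y * j = 2 * (h * h' * y * j) by ring, hmul (hne_of_dvd ⟨1, by ring⟩),
    padicValNat.mul (by simp [hprod]) (by simp [hprod]),
    padicValNat.mul (by simp [hprod]) (by simp [hprod]), padicValNat.mul hprod.1.1.1 hprod.1.1.2]
  omega

theorem padicValInt_triple_le_iff_of_dvd_of_not_dvd_lucasU [Fact q.Prime] (hab : IsCoprime a b)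
    (hD : D ^ 2 ∣ a ^ 2 + 4 * b) (hg : g ∣ 2) (hgy : 2 ∣ g * y) (hxy : (g * h).Coprime y)
    (hzy : (g * h').Coprime y) (hne : lucasU a b (g * h * h' * y * j) ≠ 0)
    (hqg : ¬ (q : ℤ) ∣ lucasU a b g) (hqD : (q : ℤ) ∣ D) :
    2 * padicValInt q D + (padicValInt q (lucasU a b (g * h)) + padicValInt q (lucasU a b y) +
        padicValInt q (lucasU a b (g * h'))) ≤
      padicValInt q (lucasU a b (g * h * h' * y * j)) ↔
    2 * padicValInt q D + (padicValInt q (lucasU a b g) - padicValNat q y) ≤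
      padicValNat q j := by
  have hqΔ : (q : ℤ) ^ 2 ∣ a ^ 2 + 4 * b := (pow_dvd_pow_of_dvd hqD 2).trans hD
  have hqΔ' : (q : ℤ) ∣ a ^ 2 + 4 * b := (dvd_pow_self _ two_ne_zero).trans hqΔ
  have hg1 (hq2 : q = 2) : g = 1 := ((Nat.dvd_prime Nat.prime_two).1 hg).resolve_right <| by
    subst hq2
    rintro rfl
    exact hqg (by simpa using two_dvd_of_two_dvd_discrim hqΔ')
  have hy2 (hq2 : q = 2) : 2 ∣ y := by simpa [hg1 hq2] using hgy
  have hgq : padicValNat q g = 0 := padicValNat.eq_zero_of_not_dvd fun hqg' =>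
    hqg ((prime_dvd_lucasU_self hab hqΔ').trans (lucasU_dvd_lucasU a b hqg'))
  have hcop {x : ℕ} (hx : x.Coprime y) (hx0 : lucasU a b x ≠ 0) :
      padicValInt q (lucasU a b x) = padicValNat q x := by
    by_cases hq2 : q = 2
    · have hqx : ¬ q ∣ x := fun hqx =>
        Nat.not_coprime_of_dvd_of_dvd one_lt_two (hq2 ▸ hqx) (hy2 hq2) hx
      rw [padicValNat.eq_zero_of_not_dvd hqx, padicValInt.eq_zero_of_not_dvd]
      exact prime_not_dvd_lucasU hab hqΔ' hqx
    · exact padicValInt_lucasU hab hqΔ (fun h => absurd h hq2) hx0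
  have hne_of_dvd {k : ℕ} (hk : k ∣ g * h * h' * y * j) : lucasU a b k ≠ 0 :=
    ne_zero_of_dvd_ne_zero hne (lucasU_dvd_lucasU a b hk)
  have hprod : g * h * h' * y * j ≠ 0 := fun h0 => hne (by rw [h0, lucasU_zero])
  rw [hcop hxy (hne_of_dvd ⟨h' * y * j, by ring⟩), hcop hzy (hne_of_dvd ⟨h * y * j, by ring⟩),
    show g * h * h' * y * j = y * (g * h * h' * j) by ring,
    padicValInt_lucasU_mul hab (hqΔ.mul_right _) hy2 (hne_of_dvd ⟨1, by ring⟩)]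
  simp only [mul_ne_zero_iff] at hprod
  rw [padicValNat.mul (by simp [hprod]) hprod.2,
    padicValNat.mul (mul_ne_zero hprod.1.1.1.1 hprod.1.1.1.2) hprod.1.1.2,
    padicValNat.mul hprod.1.1.1.1 hprod.1.1.1.2, padicValNat.mul hprod.1.1.1.1 hprod.1.1.2, hgq,
    padicValInt.eq_zero_of_not_dvd hqg]
  omega

theorem padicValInt_triple_le_of_not_dvd_lucasU [Fact q.Prime] (hab : IsCoprime a b)
    (hxy : (g * h).Coprime y) (hzy : (g * h').Coprime y) (hh : h.Coprime h')
    (hne : lucasU a b (g * h * h' * y * j) ≠ 0) (hqg : ¬ (q : ℤ) ∣ lucasU a b g) :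
    padicValInt q (lucasU a b (g * h)) + padicValInt q (lucasU a b y) +
        padicValInt q (lucasU a b (g * h')) ≤
      padicValInt q (lucasU a b (g * h * h' * y * j)) := by
  have hq' : Prime (q : ℤ) := Nat.prime_iff_prime_int.1 Fact.out
  have hle {k : ℕ} (hk : k ∣ g * h * h' * y * j) :
      padicValInt q (lucasU a b k) ≤ padicValInt q (lucasU a b (g * h * h' * y * j)) := by
    have hk' := lucasU_dvd_lucasU a b hk
    exact (int_dvd_iff_padicValInt_le (ne_zero_of_dvd_ne_zero hne hk') hne).1 hk' q
  have hx := hle (k := g * h) ⟨h' * y * j, by ring⟩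
  have hy := hle (k := y) ⟨g * h * h' * j, by ring⟩
  have hz := hle (k := g * h') ⟨h * y * j, by ring⟩
  have hzero {k l : ℕ} (hkl : ¬ (q : ℤ) ∣ lucasU a b (k.gcd l)) :
      padicValInt q (lucasU a b k) = 0 ∨ padicValInt q (lucasU a b l) = 0 := by
    by_contra! hv
    have hdvd {k : ℕ} (hv : padicValInt q (lucasU a b k) ≠ 0) : (q : ℤ) ∣ lucasU a b k :=
      not_imp_comm.1 padicValInt.eq_zero_of_not_dvd hv
    exact hkl (dvd_lucasU_gcd hab (hdvd hv.1) (hdvd hv.2))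
  have hq1 : ¬ (q : ℤ) ∣ lucasU a b 1 := by simpa using hq'.not_dvd_one
  have hxy' := hzero (k := g * h) (l := y) (by rwa [hxy])
  have hzy' := hzero (k := g * h') (l := y) (by rwa [hzy])
  have hxz' := hzero (k := g * h) (l := g * h') (by rwa [Nat.gcd_mul_left, hh, mul_one])
  omega

theorem sq_mul_triple_dvd_lucasU_iff (hab : IsCoprime a b) (hD0 : D ≠ 0)
    (hD : D ^ 2 ∣ a ^ 2 + 4 * b) (hg : g ∣ 2) (hgy : 2 ∣ g * y) (hxy : (g * h).Coprime y)
    (hzy : (g * h').Coprime y) (hh : h.Coprime h')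
    (hne : lucasU a b (g * h * h' * y * j) ≠ 0) :
    D ^ 2 * (lucasU a b (g * h) * lucasU a b y * lucasU a b (g * h')) ∣
        lucasU a b (g * h * h' * y * j) ↔
      D ^ 2 * lucasCofactor a b g y ∣ (j : ℤ) := by
  have hne_of_dvd {k : ℕ} (hk : k ∣ g * h * h' * y * j) : lucasU a b k ≠ 0 :=
    ne_zero_of_dvd_ne_zero hne (lucasU_dvd_lucasU a b hk)
  have hx0 := hne_of_dvd (k := g * h) ⟨h' * y * j, by ring⟩
  have hy0 := hne_of_dvd (k := y) ⟨g * h * h' * j, by ring⟩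
  have hz0 := hne_of_dvd (k := g * h') ⟨h * y * j, by ring⟩
  have hg0 := hne_of_dvd (k := g) ⟨h * h' * y * j, by ring⟩
  have hprod : g * h * h' * y * j ≠ 0 := fun h0 => hne (by rw [h0, lucasU_zero])
  have hcofactor : lucasCofactor a b g y ≠ 0 := lucasCofactor_ne_zero hg0
  rw [int_dvd_iff_padicValInt_le (by positivity) hne,
    int_dvd_iff_padicValInt_le (by positivity) (by exact_mod_cast right_ne_zero_of_mul hprod)]
  refine forall₂_congr fun q _ => ?_
  rw [padicValInt.mul (by positivity) (by positivity), padicValInt.mul (by positivity) hz0,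
    padicValInt.mul hx0 hy0, padicValInt.mul (by positivity) hcofactor, pow_two,
    padicValInt.mul hD0 hD0, ← two_mul, lucasCofactor,
    padicValInt_ediv_gcd hg0 (right_ne_zero_of_mul (left_ne_zero_of_mul hprod)),
    padicValInt.of_nat]
  by_cases hqg : (q : ℤ) ∣ lucasU a b g
  · exact padicValInt_triple_le_iff_of_dvd_lucasU hab hD hg hxy hne hqg
  by_cases hqD : (q : ℤ) ∣ D
  · exact padicValInt_triple_le_iff_of_dvd_of_not_dvd_lucasU hab hD hg hgy hxy hzy hne hqg hqD
  · have hle := padicValInt_triple_le_of_not_dvd_lucasU hab hxy hzy hh hne hqg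
    rw [padicValInt.eq_zero_of_not_dvd hqD, padicValInt.eq_zero_of_not_dvd hqg]
    omega

end Triple

section OrderOfAppearance

theorem isLeast_orderOfAppearance_and_eq {a b m t : ℤ} (ht : 0 < t)
    (h : ∀ k : ℕ, 0 < k → (m ∣ lucasU a b k ↔ t ∣ k)) :
    IsLeast (appearanceSet a b m) (orderOfAppearance a b m) ∧
      (orderOfAppearance a b m : ℤ) = t := by
  lift t to ℕ using ht.le
  have ht' : 0 < t := by exact_mod_cast ht
  have hleast : IsLeast (appearanceSet a b m) t :=
    ⟨⟨ht', (h t ht').2 dvd_rfl⟩, fun k ⟨hk, hmk⟩ =>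
      Nat.le_of_dvd hk (by exact_mod_cast (h k hk).1 hmk)⟩
  have heq : orderOfAppearance a b m = t := hleast.csInf_eq
  exact ⟨heq ▸ hleast, by rw [heq]⟩

theorem gcd_add_two_mul {m c : ℕ} (hmc : m.Coprime c) : m.gcd (m + 2 * c) = m.gcd 2 := by
  rw [Nat.gcd_self_add_right, hmc.symm.gcd_mul_right_cancel_right]

theorem coprime_add_two_mul_add {m c : ℕ} (hmc : m.Coprime c) : (m + 2 * c).Coprime (m + c) := by
  rw [two_mul, ← add_assoc, Nat.coprime_self_add_left, Nat.coprime_add_self_right]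
  exact hmc.symm

theorem mul_lcm_mul_dvd {d x y z k : ℕ} (hd : 0 < d) (hxy : x.Coprime y) (hzy : z.Coprime y)
    (hx : d * x ∣ k) (hy : d * y ∣ k) (hz : d * z ∣ k) : d * (x.lcm z * y) ∣ k := by
  obtain ⟨k, rfl⟩ := (dvd_mul_right d x).trans hx
  rw [Nat.mul_dvd_mul_iff_left hd] at hx hy hz ⊢
  have hlcm : (x.lcm z).Coprime y := (hxy.mul_left hzy).coprime_dvd_left (Nat.lcm_dvd_mul x z)
  exact hlcm.mul_dvd_of_dvd_of_dvd (Nat.lcm_dvd hx hz) hy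

theorem two_dvd_gcd_two_mul_add (m : ℕ) {c : ℕ} (hc : Odd c) : 2 ∣ m.gcd 2 * (m + c) := by
  rcases m.even_or_odd with hm | hm
  · exact (Nat.dvd_gcd hm.two_dvd dvd_rfl).mul_right _
  · exact (hm.add_odd hc).two_dvd.mul_left _

variable {a b : ℤ}

theorem triple_dvd_lucasU_mul_iff (hab : IsCoprime a b) {d m c j : ℕ} (hmc : m.Coprime c)
    (hc : Odd c) (hne : lucasU a b (d * (m.lcm (m + 2 * c) * (m + c)) * j) ≠ 0) :
    lucasU a b (d * m) * lucasU a b (d * (m + c)) * lucasU a b (d * (m + 2 * c)) ∣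
        lucasU a b (d * (m.lcm (m + 2 * c) * (m + c)) * j) ↔
      lucasU a b d ^ 2 * lucasCofactor (lucasV a b d) (-(-b) ^ d) (m.gcd 2) (m + c) ∣
        (j : ℤ) := by
  obtain ⟨h, h', hh, hm, hm'⟩ := Nat.exists_coprime m (m + 2 * c)
  rw [gcd_add_two_mul hmc, mul_comm _ (m.gcd 2)] at hm hm'
  have hlcm : m.lcm (m + 2 * c) = m.gcd 2 * h * h' := by
    calc m.lcm (m + 2 * c) = (m.gcd 2 * h).lcm (m.gcd 2 * h') := by rw [← hm, ← hm']
      _ = m.gcd 2 * h * h' := by rw [Nat.lcm_mul_left, hh.lcm_eq_mul, mul_assoc]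
  have hxy : (m.gcd 2 * h).Coprime (m + c) := by
    rw [← hm]; exact Nat.coprime_self_add_right.2 hmc
  have hzy : (m.gcd 2 * h').Coprime (m + c) := by
    rw [← hm']; exact coprime_add_two_mul_add hmc
  rw [hlcm, mul_assoc d] at hne ⊢
  simp only [lucasU_mul a b d] at hne ⊢
  obtain ⟨hd, hne⟩ := mul_ne_zero_iff.1 hne
  have hiff := sq_mul_triple_dvd_lucasU_iff (isCoprime_lucasV hab d) hd
    (discrim_lucasV a b d ▸ dvd_mul_left _ _) (Nat.gcd_dvd_right m 2)
    (two_dvd_gcd_two_mul_add m hc) hxy hzy hh hne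
  rw [← hm, ← hm', ← mul_dvd_mul_iff_left hd] at hiff
  rw [← hiff, ← hm]
  ring_nf

theorem dvd_of_triple_dvd_lucasU (hab : IsCoprime a b) (hb : b ≠ 0) (ha : 0 < a)
    (hΔ : 0 < a ^ 2 + 4 * b) {n p k : ℕ} (hn : 0 < n) (hp : 1 < p)
    (h : lucasU a b n * lucasU a b (n + p) * lucasU a b (n + 2 * p) ∣ lucasU a b k) :
    n ∣ k ∧ n + p ∣ k ∧ n + 2 * p ∣ k := by
  have hy : n + p ∣ k := dvd_of_lucasU_dvd_lucasU hab hb ha hΔ (by omega)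
    (((dvd_mul_left _ _).mul_right _).trans h)
  have hz : n + 2 * p ∣ k := dvd_of_lucasU_dvd_lucasU hab hb ha hΔ (by omega)
    ((dvd_mul_left _ _).trans h)
  refine ⟨?_, hy, hz⟩
  rcases eq_or_ne n 2 with rfl | hn2
  · exact (show 2 ∣ 2 + 2 * p from ⟨1 + p, by ring⟩).trans hz
  · exact dvd_of_lucasU_dvd_lucasU hab hb ha hΔ hn2
      (((dvd_mul_right _ _).mul_right _).trans h)

theorem triple_dvd_lucasU_iff (hab : IsCoprime a b) (hb : b ≠ 0) (ha : 0 < a)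
    (hΔ : 0 < a ^ 2 + 4 * b) {d m c : ℕ} (hm : 0 < m) (hmc : m.Coprime c) (hc : Odd c)
    (hdc : 1 < d * c) {k : ℕ} (hk : 0 < k) :
    lucasU a b (d * m) * lucasU a b (d * (m + c)) * lucasU a b (d * (m + 2 * c)) ∣
        lucasU a b k ↔
      (d * (m.lcm (m + 2 * c) * (m + c)) : ℕ) * (lucasU a b d ^ 2 *
        lucasCofactor (lucasV a b d) (-(-b) ^ d) (m.gcd 2) (m + c)) ∣ (k : ℤ) := by
  have hd : 0 < d := Nat.pos_of_ne_zero (by rintro rfl; simp at hdc)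
  by_cases hL : d * (m.lcm (m + 2 * c) * (m + c)) ∣ k
  · obtain ⟨j, rfl⟩ := hL
    have hne := (lucasU_pos ha hΔ hk).ne'
    rw [triple_dvd_lucasU_mul_iff hab hmc hc hne, Nat.cast_mul _ j, mul_dvd_mul_iff_left]
    exact_mod_cast (Nat.pos_of_mul_pos_right hk).ne'
  · refine iff_of_false (fun h => hL ?_) fun h => hL ?_
    · have hy : d * (m + c) = d * m + d * c := by ring
      have hz : d * (m + 2 * c) = d * m + 2 * (d * c) := by ring
      have hdvd : d * m ∣ k ∧ d * (m + c) ∣ k ∧ d * (m + 2 * c) ∣ k := by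
        rw [hy, hz] at h ⊢
        exact dvd_of_triple_dvd_lucasU hab hb ha hΔ (by positivity) hdc h
      exact mul_lcm_mul_dvd hd (Nat.coprime_self_add_right.2 hmc) (coprime_add_two_mul_add hmc)
        hdvd.1 hdvd.2.1 hdvd.2.2
    · exact_mod_cast (dvd_mul_right _ _).trans h

theorem orderOfAppearance_triple (hab : IsCoprime a b) (hb : b ≠ 0) (ha : 0 < a)
    (hΔ : 0 < a ^ 2 + 4 * b) {d m c : ℕ} (hm : 0 < m) (hmc : m.Coprime c) (hc : Odd c)
    (hdc : 1 < d * c) {N : ℤ}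
    (hN : N = lucasU a b (d * m) * lucasU a b (d * (m + c)) * lucasU a b (d * (m + 2 * c))) :
    IsLeast (appearanceSet a b N) (orderOfAppearance a b N) ∧
      (orderOfAppearance a b N : ℚ) =
        d * m * (m + c) * (m + 2 * c) / m.gcd 2 *
          (lucasU a b d ^ 2 *
            lucasCofactor (lucasV a b d) (-(-b) ^ d) (m.gcd 2) (m + c)) := by
  have hd : 0 < d := Nat.pos_of_ne_zero (by rintro rfl; simp at hdc)
  have hU := lucasU_pos ha hΔ hd
  have hUg : 0 < lucasU (lucasV a b d) (-(-b) ^ d) (m.gcd 2) :=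
    lucasU_pos (lucasV_pos ha hΔ hd) (by rw [discrim_lucasV]; positivity)
      (Nat.gcd_pos_of_pos_left 2 hm)
  have hcofactor := lucasCofactor_pos (y := m + c) hUg
  have : 0 < m.lcm (m + 2 * c) := Nat.lcm_pos hm (by positivity)
  have hgcd_lcm : (m.gcd 2 * m.lcm (m + 2 * c) : ℚ) = m * (m + 2 * c) := by
    exact_mod_cast gcd_add_two_mul hmc ▸ Nat.gcd_mul_lcm m (m + 2 * c)
  have hg : (m.gcd 2 : ℚ) ≠ 0 := by exact_mod_cast (Nat.gcd_pos_of_pos_left 2 hm).ne'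
  obtain ⟨hleast, hτ⟩ := isLeast_orderOfAppearance_and_eq (by positivity)
    fun k hk => hN ▸ triple_dvd_lucasU_iff hab hb ha hΔ hm hmc hc hdc hk
  refine ⟨hleast, ?_⟩
  rw [← Int.cast_natCast, hτ]
  push_cast
  rw [show (d * m * (m + c) * (m + 2 * c) : ℚ) = d * (m * (m + 2 * c)) * (m + c) by ring,
    ← hgcd_lcm]
  field_simp

end OrderOfAppearance

theorem theorem1p2_general (a b : ℤ) (hab : IsCoprime a b) (hb : b ≠ 0) (ha : 0 < a)
    (hΔ : 0 < a ^ 2 + 4 * b) (n p : ℕ) (hn : 0 < n) (hp : Odd p) (hp1 : 1 < p) :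
    0 < lucasU a b n * lucasU a b (n + p) * lucasU a b (n + 2 * p) ∧
    IsCoprime (lucasU a b n * lucasU a b (n + p) * lucasU a b (n + 2 * p)) b ∧
    IsLeast (appearanceSet a b (lucasU a b n * lucasU a b (n + p) * lucasU a b (n + 2 * p)))
      (orderOfAppearance a b (lucasU a b n * lucasU a b (n + p) * lucasU a b (n + 2 * p))) ∧
    (¬ 2 ∣ n →
      (orderOfAppearance a b
          (lucasU a b n * lucasU a b (n + p) * lucasU a b (n + 2 * p)) : ℚ) =
        (n * (n + p) * (n + 2 * p)) / n.gcd p ^ 2 * lucasU a b (n.gcd p) ^ 2) ∧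
    (2 ∣ n →
      (orderOfAppearance a b
          (lucasU a b n * lucasU a b (n + p) * lucasU a b (n + 2 * p)) : ℚ) =
        (n * (n + p) * (n + 2 * p)) / (2 * n.gcd p ^ 2) *
          ((lucasU a b (n.gcd p) ^ 2 * lucasV a b (n.gcd p)) /
            Int.gcd (lucasV a b (n.gcd p)) (((n + p) / n.gcd p : ℕ) : ℤ))) := by
  have hx := lucasU_pos ha hΔ hn
  have hy := lucasU_pos ha hΔ (show 0 < n + p by omega)
  have hz := lucasU_pos ha hΔ (show 0 < n + 2 * p by omega)
  refine ⟨by positivity, ?_, ?_⟩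
  · exact ((isCoprime_lucasU hab hn).mul_left (isCoprime_lucasU hab (by omega))).mul_left
      (isCoprime_lucasU hab (by omega))
  obtain ⟨m, c, hmc, hnm, hpc⟩ := Nat.exists_coprime n p
  generalize n.gcd p = d at hnm hpc ⊢
  subst hnm hpc
  have hd := Nat.pos_of_mul_pos_left hn
  have hd' : (d : ℚ) ≠ 0 := by exact_mod_cast hd.ne'
  have hc : Odd c := Nat.Odd.of_mul_left hp
  have hd2 : Nat.Coprime 2 d := (Nat.Odd.of_mul_right hp).coprime_two_left
  obtain ⟨hleast, hτ⟩ := orderOfAppearance_triple hab hb ha hΔ (d := d)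
    (Nat.pos_of_mul_pos_right hn) hmc hc (by rwa [mul_comm]) rfl
  rw [show m * d + c * d = d * (m + c) by ring, show m * d + 2 * (c * d) = d * (m + 2 * c) by ring,
    mul_comm m d, hτ]
  refine ⟨hleast, fun h2 => ?_, fun h2 => ?_⟩
  · have hm2 : m.gcd 2 = 1 :=
      (Nat.prime_two.coprime_iff_not_dvd.2 fun hm2 => h2 (hm2.mul_left d)).symm
    rw [hm2, lucasCofactor_one]
    push_cast
    field_simp
  · have hm2 : m.gcd 2 = 2 := Nat.gcd_eq_right (hd2.dvd_of_dvd_mul_left h2)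
    rw [hm2, cast_lucasCofactor (by simpa using (lucasV_pos ha hΔ hd).ne'), lucasU_two,
      Nat.mul_div_cancel_left _ hd]
    push_cast
    field_simp

theorem theorem1p2 (a b : ℤ) (hab : IsCoprime a b) (hb : b ≠ 0) (ha : 0 < a)
    (hΔ : 0 < a ^ 2 + 4 * b) (n p : ℕ) (hn : 0 < n) (hp : p.Prime) (hp3 : 3 ≤ p) :
    -- `m = U_n U_{n+p} U_{n+2p}` is positive and prime to `b`, and the minimum `τ(m)` is attained
    0 < lucasU a b n * lucasU a b (n + p) * lucasU a b (n + 2 * p) ∧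
    IsCoprime (lucasU a b n * lucasU a b (n + p) * lucasU a b (n + 2 * p)) b ∧
    IsLeast (appearanceSet a b (lucasU a b n * lucasU a b (n + p) * lucasU a b (n + 2 * p)))
      (orderOfAppearance a b (lucasU a b n * lucasU a b (n + p) * lucasU a b (n + 2 * p))) ∧
    -- the four cases, with all divisions taken in `ℚ`, except `(n + p) / p`, which is exact
    (¬ p ∣ n → ¬ 2 ∣ n →
      (orderOfAppearance a b
          (lucasU a b n * lucasU a b (n + p) * lucasU a b (n + 2 * p)) : ℚ) =
        n * (n + p) * (n + 2 * p)) ∧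
    (¬ p ∣ n → 2 ∣ n →
      (orderOfAppearance a b
          (lucasU a b n * lucasU a b (n + p) * lucasU a b (n + 2 * p)) : ℚ) =
        (n * (n + p) * (n + 2 * p)) / 2 * (a / Int.gcd a ((n + p : ℕ) : ℤ))) ∧
    (p ∣ n → ¬ 2 ∣ n →
      (orderOfAppearance a b
          (lucasU a b n * lucasU a b (n + p) * lucasU a b (n + 2 * p)) : ℚ) =
        (n * (n + p) * (n + 2 * p)) / p ^ 2 * lucasU a b p ^ 2) ∧
    (p ∣ n → 2 ∣ n →
      (orderOfAppearance a b
          (lucasU a b n * lucasU a b (n + p) * lucasU a b (n + 2 * p)) : ℚ) =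
        (n * (n + p) * (n + 2 * p)) / (2 * p ^ 2) *
          ((lucasU a b p ^ 2 * lucasV a b p) /
            Int.gcd (lucasV a b p) (((n + p) / p : ℕ) : ℤ))) := by
  obtain ⟨hpos, hcop, hleast, hodd, heven⟩ := theorem1p2_general a b hab hb ha hΔ n p hn
    (hp.odd_of_ne_two (by omega)) hp.one_lt
  have hgcd (h : ¬ p ∣ n) : n.gcd p = 1 := ((hp.coprime_iff_not_dvd).2 h).symm
  refine ⟨hpos, hcop, hleast, fun h h2 => ?_, fun h h2 => ?_, fun h h2 => ?_, fun h h2 => ?_⟩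
  · simpa [hgcd h] using hodd h2
  · simpa [hgcd h] using heven h2
  · simpa [Nat.gcd_eq_right h] using hodd h2
  · simpa [Nat.gcd_eq_right h] using heven h2
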